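/- For each sample size $n$ let $p=p_n$ and $k=k_n$ be integers with $1\le k\le p$ and let $\sigma=\sigma_n>0$, $\tau=\tau_n>0$. Consider the linear model $y_i=x_i^T\beta+\sigma z_i$, $i=1,\dots,n$, with $\beta\in\mathbb{R}^p$, $x_i\overset{iid}{\sim}\mathcal N(0,\frac1n I_p)$ and $z_i\overset{iid}{\sim}\mathcal N(0,1)$ independent of the $x_i$; write $\mathbb{E}_\beta$ for the expectation under this model. Let $$\Theta(k,\tau)=\{\beta\in\mathbb{R}^p:\ \|\beta\|_0\le k,\ \|\beta\|_2^2\le k\tau^2\},\qquad R(\Theta(k,\tau),\sigma)=\inf_{\hat\beta}\ \sup_{\beta\in\Theta(k,\tau)}\mathbb{E}_\beta\|\hat\beta-\beta\|_2^2,$$ where $\|\beta\|_0$ is the number of non-zero components of $\beta$ and the infimum is over all estimators, i.e. measurable functions of $(x_i,y_i)_{i\le n}$. Let $\hat\beta^{BS}$ be the best subset selection estimator, i.e. any (measurable) choice $$\hat\beta^{BS}\in\operatorname*{arg\,min}_{b\in\mathbb{R}^p:\ \|b\|_0\le k}\ \sum_{i=1}^n (y_i-x_i^Tb)^2 .$$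 Suppose that, as $n\to\infty$, $k/p\to0$, $(k\log p)/n\to0$ and $\tau/\sigma=o\big(\sqrt{\log(p/k)}\big)$ (this covers both the low-SNR regime $\tau/\sigma\to0$ and the moderate-SNR regime $\tau/\sigma\to\infty$, $\tau/\sigma=o(\sqrt{\log(p/k)})$). Then, as $n\to\infty$, $$\frac{\sup_{\beta\in\Theta(k,\tau)}\mathbb{E}_\beta\|\hat\beta^{BS}-\beta\|_2^2}{R(\Theta(k,\tau),\sigma)}\ \longrightarrow\ \infty .$$ -/

import Mathlib

open scoped ENNReal NNReal Topology
open MeasureTheory ProbabilityTheory Filter Asymptotics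

namespace SparseRegression

/-- Covariates of the `n` samples: `x i` is the covariate vector `x_i ∈ ℝ^p`, i.e. the `i`-th row
of the design matrix. -/
abbrev Design (n p : ℕ) : Type := Fin n → Fin p → ℝ

/-- An (unrestricted) estimation rule: a map from the data `(X, y)` to `ℝ^p`, where `ℝ^p` carries
the Euclidean norm. -/
abbrev Estimator (n p : ℕ) : Type := Design n p × (Fin n → ℝ) → EuclideanSpace ℝ (Fin p)

/-- The linear predictor `(x_iᵀ b)_{i = 1, …, n}`. -/
def predict {n p : ℕ} (x : Design n p) (b : EuclideanSpace ℝ (Fin p)) : Fin n → ℝ :=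
  fun i => ∑ j, x i j * b j

/-- The number of non-zero components of a vector. -/
noncomputable def l0 {p : ℕ} (b : EuclideanSpace ℝ (Fin p)) : ℕ :=
  (Finset.univ.filter fun j => b j ≠ 0).card

/-- The parameter space `Θ(k, τ) = {β ∈ ℝ^p : ‖β‖₀ ≤ k, ‖β‖₂² ≤ k τ²}`. -/
def Theta (p k : ℕ) (τ : ℝ) : Set (EuclideanSpace ℝ (Fin p)) :=
  {β | l0 β ≤ k ∧ ‖β‖ ^ 2 ≤ k * τ ^ 2}

/-- Law of the covariates: `x_1, …, x_n` i.i.d. `N(0, (1/n) I_p)`. -/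
noncomputable def designLaw (n p : ℕ) : Measure (Design n p) :=
  Measure.pi fun _ => Measure.pi fun _ => gaussianReal 0 (1 / (n : ℝ≥0))

/-- Law of the errors: `z_1, …, z_n` i.i.d. `N(0, 1)`. -/
noncomputable def noiseLaw (n : ℕ) : Measure (Fin n → ℝ) :=
  Measure.pi fun _ => gaussianReal 0 1

/-- Law of the data `(X, y)` under `y_i = x_iᵀ β + σ z_i`, with `z` independent of `X`. -/
noncomputable def dataLaw (n p : ℕ) (σ : ℝ) (β : EuclideanSpace ℝ (Fin p)) :
    Measure (Design n p × (Fin n → ℝ)) :=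
  ((designLaw n p).prod (noiseLaw n)).map fun w => (w.1, predict w.1 β + σ • w.2)

/-- The risk `E_β ‖δ(X, y) - β‖₂²`, as an extended nonnegative number. -/
noncomputable def risk {n p : ℕ} (σ : ℝ) (δ : Estimator n p)
    (β : EuclideanSpace ℝ (Fin p)) : ℝ≥0∞ :=
  ∫⁻ d, ENNReal.ofReal (‖δ d - β‖ ^ 2) ∂(dataLaw n p σ β)

/-- The worst-case risk over `Θ(k, τ)`. -/
noncomputable def worstRisk {n p : ℕ} (k : ℕ) (τ σ : ℝ) (δ : Estimator n p) : ℝ≥0∞ :=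
  ⨆ β ∈ Theta p k τ, risk σ δ β

/-- The minimax risk `R(Θ(k, τ), σ)`: the infimum of the worst-case risk over all estimators,
i.e. all measurable functions of the data. -/
noncomputable def minimaxRisk (n p k : ℕ) (τ σ : ℝ) : ℝ≥0∞ :=
  ⨅ (δ : Estimator n p) (_ : Measurable δ), worstRisk k τ σ δ

/-- The residual sum of squares `∑ i, (y_i - x_iᵀ b)²`. -/
def rss {n p : ℕ} (d : Design n p × (Fin n → ℝ)) (b : EuclideanSpace ℝ (Fin p)) : ℝ :=
  ∑ i, (d.2 i - predict d.1 b i) ^ 2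

/-- `δ` is a best subset selection estimator with sparsity `k`: on every data set, it is a
minimizer (ties being broken arbitrarily) of the residual sum of squares over all `b` with
`‖b‖₀ ≤ k`. -/
def IsBestSubsetSelection {n p : ℕ} (k : ℕ) (δ : Estimator n p) : Prop :=
  ∀ d, l0 (δ d) ≤ k ∧ ∀ b, l0 b ≤ k → rss d (δ d) ≤ rss d b

end SparseRegression

/-!
At `β = 0` the response `y = σ z` is independent of the design `X`. Given `y`, the vector `Xᵀ y` is
`‖y‖ / √n` times an i.i.d. standard Gaussian vector `g`, and the component of `X` orthogonal to `y`
is independent of `g`. Split the `p` coordinates into `k` blocks: with probability bounded below, a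
block contains a coordinate at which `g` exceeds a level of order `√(log (p / k))`. Comparing best
subset selection with a vector supported on one such coordinate per block shows that it fits pure
noise, at the price of a squared norm of order at least `σ² k log (p / k)` in expectation. The zero
estimator has risk at most `k τ²`, so the ratio is at least of order `(σ / τ)² log (p / k)`.
-/

namespace SparseRegression

open Matrix

section GaussianReal

theorem exp_div_le_gaussianReal_Ioi {t : ℝ} (ht : 0 ≤ t) :
    Real.exp (-t ^ 2 - 1) / √(2 * Real.pi) ≤ (gaussianReal 0 1).real (Set.Ioi t) := by
  rw [measureReal_def, gaussianReal_apply_eq_integral 0 one_ne_zero, ENNReal.toReal_ofReal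
    (setIntegral_nonneg measurableSet_Ioi fun x _ => gaussianPDFReal_nonneg _ _ _)]
  calc Real.exp (-t ^ 2 - 1) / √(2 * Real.pi)
      = ∫ _ in Set.Ioc t (t + 1), Real.exp (-t ^ 2 - 1) / √(2 * Real.pi) := by simp
    _ ≤ ∫ x in Set.Ioc t (t + 1), gaussianPDFReal 0 1 x := by
        refine setIntegral_mono_on (by simp) (integrable_gaussianPDFReal 0 1).integrableOn
          measurableSet_Ioc fun x hx => ?_
        rw [gaussianPDFReal, div_eq_inv_mul]
        simp only [NNReal.coe_one, mul_one, sub_zero]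
        gcongr
        nlinarith [hx.1, hx.2, sq_nonneg (t - 1)]
    _ ≤ ∫ x in Set.Ioi t, gaussianPDFReal 0 1 x :=
        setIntegral_mono_set (integrable_gaussianPDFReal 0 1).integrableOn
          (ae_of_all _ fun x => gaussianPDFReal_nonneg _ _ _)
          Set.Ioc_subset_Ioi_self.eventuallyLE

theorem gaussianPDFReal_mul_exp_sq_div_four (x : ℝ) :
    gaussianPDFReal 0 1 x * Real.exp (x ^ 2 / 4) =
      (√(2 * Real.pi))⁻¹ * Real.exp (-(1 / 4) * x ^ 2) := by
  rw [gaussianPDFReal, mul_assoc, ← Real.exp_add]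
  simp only [NNReal.coe_one, mul_one, sub_zero]
  ring_nf

theorem integrable_exp_sq_div_four :
    Integrable (fun x : ℝ => Real.exp (x ^ 2 / 4)) (gaussianReal 0 1) := by
  rw [gaussianReal_of_var_ne_zero _ one_ne_zero, integrable_withDensity_iff_integrable_smul'
    (measurable_gaussianPDF _ _) (ae_of_all _ fun _ => gaussianPDF_lt_top)]
  simp only [toReal_gaussianPDF, smul_eq_mul, gaussianPDFReal_mul_exp_sq_div_four]
  exact (integrable_exp_neg_mul_sq (by norm_num)).const_mul _

theorem integral_exp_sq_div_four : ∫ x, Real.exp (x ^ 2 / 4) ∂(gaussianReal 0 1) = √2 := by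
  rw [integral_gaussianReal_eq_integral_smul one_ne_zero]
  simp only [smul_eq_mul, gaussianPDFReal_mul_exp_sq_div_four]
  rw [integral_const_mul, integral_gaussian, ← Real.sqrt_inv, ← Real.sqrt_mul (by positivity)]
  congr 1
  field_simp
  norm_num

theorem integrable_sq_gaussianReal (v : ℝ≥0) :
    Integrable (fun x : ℝ => x ^ 2) (gaussianReal 0 v) :=
  (memLp_id_gaussianReal' 2 (by simp)).integrable_sq

theorem integral_sq_gaussianReal (v : ℝ≥0) : ∫ x, x ^ 2 ∂(gaussianReal 0 v) = v := by
  rw [← variance_id_gaussianReal (μ := 0) (v := v), variance_of_integral_eq_zero aemeasurable_id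
    integral_id_gaussianReal]
  rfl

end GaussianReal

section GlueRow

variable {ι m l : Type*} [Fintype l]

/-- The matrix `c (P W + u gᵀ)`, where `w = (g, W)`: the product of `c (P | u)` with the matrix that
has blocks `W` and `gᵀ`. When `(P | u)` has orthonormal rows, it takes i.i.d. centred Gaussian
entries to i.i.d. centred Gaussian entries. -/
noncomputable def glueRow (c : ℝ) (P : Matrix m l ℝ) (u : m → ℝ) (w : (ι → ℝ) × (l → ι → ℝ)) :
    m → ι → ℝ :=
  of.symm (c • (P * of w.2 + vecMulVec u w.1))

theorem measurable_glueRow (c : ℝ) (P : Matrix m l ℝ) (u : m → ℝ) :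
    Measurable (glueRow c P u : (ι → ℝ) × (l → ι → ℝ) → m → ι → ℝ) := by
  refine measurable_pi_iff.2 fun i => measurable_pi_iff.2 fun j => ?_
  have happly (w : (ι → ℝ) × (l → ι → ℝ)) :
      glueRow c P u w i j = c * (∑ r, P i r * w.2 r j + u i * w.1 j) := rfl
  simp only [happly]
  fun_prop

variable [Fintype ι] [Fintype m]

theorem trace_glueRow_mul_transpose (c : ℝ) (P : Matrix m l ℝ) (u : m → ℝ) (C : Matrix m ι ℝ)
    (w : (ι → ℝ) × (l → ι → ℝ)) :
    trace (of (glueRow c P u w) * Cᵀ) =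
      w.1 ⬝ᵥ (c • u ᵥ* C) + trace (of w.2 * (c • (Pᵀ * C))ᵀ) := by
  rw [glueRow, Equiv.apply_symm_apply, Matrix.smul_mul, Matrix.add_mul, trace_smul, trace_add,
    vecMulVec_mul, trace_vecMulVec, vecMul_transpose, transpose_smul, transpose_mul,
    transpose_transpose, Matrix.mul_smul, trace_smul, dotProduct_smul, Matrix.mul_assoc,
    trace_mul_comm P, Matrix.mul_assoc, smul_add, dotProduct_mulVec, dotProduct_comm, add_comm]

theorem dotProduct_add_trace_of_mul_transpose_add_vecMulVec_eq_one [DecidableEq m]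
    {P : Matrix m l ℝ} {u : m → ℝ} (hPu : P * Pᵀ + vecMulVec u u = 1) (C : Matrix m ι ℝ) :
    (u ᵥ* C) ⬝ᵥ (u ᵥ* C) + trace ((Pᵀ * C) * (Pᵀ * C)ᵀ) = trace (C * Cᵀ) := by
  calc (u ᵥ* C) ⬝ᵥ (u ᵥ* C) + trace ((Pᵀ * C) * (Pᵀ * C)ᵀ)
      = trace ((P * Pᵀ + vecMulVec u u) * (C * Cᵀ)) := by
        rw [Matrix.add_mul, trace_add, vecMulVec_mul, trace_vecMulVec, ← vecMul_vecMul,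
          vecMul_transpose, dotProduct_mulVec, transpose_mul, transpose_transpose,
          trace_mul_comm, add_comm, Matrix.mul_assoc, trace_mul_comm Cᵀ]
        simp only [Matrix.mul_assoc]
    _ = trace (C * Cᵀ) := by rw [hPu, one_mul]

end GlueRow

section IidGaussian

variable {ι m l : Type*} [Fintype ι] [Fintype m] [Fintype l]

/-- The law of a vector with i.i.d. `N(0, v)` entries. Reducible, so that `noiseLaw n` and the rows
of `designLaw n p` are instances of it by definition. -/
noncomputable abbrev iidGaussian (ι : Type*) [Fintype ι] (v : ℝ≥0) : Measure (ι → ℝ) :=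
  Measure.pi fun _ => gaussianReal 0 v

theorem integral_cexp_dotProduct_iidGaussian (v : ℝ≥0) (c : ι → ℝ) :
    ∫ x, Complex.exp ((x ⬝ᵥ c : ℝ) * Complex.I) ∂(iidGaussian ι v) =
      Complex.exp (-(v * (c ⬝ᵥ c) / 2 : ℝ)) := by
  have hprod (x : ι → ℝ) : Complex.exp ((x ⬝ᵥ c : ℝ) * Complex.I) =
      ∏ i, Complex.exp (c i * x i * Complex.I) := by
    rw [← Complex.exp_sum, ← Finset.sum_mul]
    simp only [dotProduct, Complex.ofReal_sum, Complex.ofReal_mul, mul_comm]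
  simp only [hprod]
  rw [integral_fintype_prod_eq_prod (fun i (x : ℝ) => Complex.exp (c i * x * Complex.I))]
  simp only [← charFun_apply_real, charFun_gaussianReal]
  rw [← Complex.exp_sum, dotProduct, Finset.mul_sum, Finset.sum_div, Complex.ofReal_sum,
    ← Finset.sum_neg_distrib]
  congr 1
  refine Finset.sum_congr rfl fun i _ => ?_
  push_cast
  ring

theorem measurePreserving_dotProduct_iidGaussian (v : ℝ≥0) (b : ι → ℝ) :
    MeasurePreserving (fun x => x ⬝ᵥ b) (iidGaussian ι v)
      (gaussianReal 0 (v * (b ⬝ᵥ b).toNNReal)) := by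
  have hmeas : Measurable fun x : ι → ℝ => x ⬝ᵥ b := by unfold dotProduct; fun_prop
  have : IsProbabilityMeasure ((iidGaussian ι v).map fun x => x ⬝ᵥ b) :=
    Measure.isProbabilityMeasure_map hmeas.aemeasurable
  refine ⟨hmeas, Measure.ext_of_charFun ?_⟩
  ext s
  have hb : 0 ≤ b ⬝ᵥ b := Finset.sum_nonneg fun i _ => mul_self_nonneg _
  rw [charFun_apply_real, integral_map hmeas.aemeasurable (by fun_prop), charFun_gaussianReal]
  have h (x : ι → ℝ) : (s * (x ⬝ᵥ b : ℝ) : ℂ) = (x ⬝ᵥ s • b : ℝ) := by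
    rw [dotProduct_smul, smul_eq_mul, Complex.ofReal_mul]
  simp only [h, integral_cexp_dotProduct_iidGaussian]
  congr 1
  rw [smul_dotProduct, dotProduct_smul, NNReal.coe_mul, Real.coe_toNNReal _ hb]
  push_cast [smul_eq_mul]
  ring

theorem integrable_dotProduct_sq_iidGaussian (v : ℝ≥0) (b : ι → ℝ) :
    Integrable (fun x => (x ⬝ᵥ b) ^ 2) (iidGaussian ι v) :=
  (measurePreserving_dotProduct_iidGaussian v b).integrable_comp_of_integrable
    (integrable_sq_gaussianReal _)

theorem integral_dotProduct_sq_iidGaussian (v : ℝ≥0) (b : ι → ℝ) :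
    ∫ x, (x ⬝ᵥ b) ^ 2 ∂(iidGaussian ι v) = v * (b ⬝ᵥ b) := by
  have hpres := measurePreserving_dotProduct_iidGaussian v b
  have hb : 0 ≤ b ⬝ᵥ b := Finset.sum_nonneg fun i _ => mul_self_nonneg _
  rw [← integral_map (f := fun y : ℝ => y ^ 2) hpres.measurable.aemeasurable (by fun_prop),
    hpres.map_eq, integral_sq_gaussianReal, NNReal.coe_mul, Real.coe_toNNReal _ hb]

theorem integrable_dotProduct_self_iidGaussian (v : ℝ≥0) :
    Integrable (fun x : ι → ℝ => x ⬝ᵥ x) (iidGaussian ι v) := by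
  simp only [dotProduct, ← sq]
  exact integrable_finsetSum _ fun i _ => integrable_comp_eval (μ := fun _ => gaussianReal 0 v)
    (i := i) (f := fun x => x ^ 2) (integrable_sq_gaussianReal v)

theorem integral_dotProduct_self_iidGaussian (v : ℝ≥0) :
    ∫ x : ι → ℝ, x ⬝ᵥ x ∂(iidGaussian ι v) = Fintype.card ι * v := by
  have hint (i : ι) : Integrable (fun x : ι → ℝ => x i ^ 2) (iidGaussian ι v) :=
    integrable_comp_eval (μ := fun _ => gaussianReal 0 v) (i := i) (f := fun x => x ^ 2)
      (integrable_sq_gaussianReal v)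
  have hcoord (i : ι) : ∫ x : ι → ℝ, x i ^ 2 ∂(iidGaussian ι v) = v :=
    (integral_comp_eval (μ := fun _ => gaussianReal 0 v) (i := i) (f := fun x => x ^ 2)
      (integrable_sq_gaussianReal v).aestronglyMeasurable).trans (integral_sq_gaussianReal v)
  simp only [dotProduct, ← sq]
  rw [integral_finsetSum _ fun i _ => hint i]
  simp [hcoord]

theorem mulVec_dotProduct_self (X : m → ι → ℝ) (b : ι → ℝ) :
    (of X *ᵥ b) ⬝ᵥ (of X *ᵥ b) = ∑ i, (X i ⬝ᵥ b) ^ 2 := by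
  simp only [dotProduct, mulVec, of_apply, sq]

theorem integrable_dotProduct_sq_row (v : ℝ≥0) (b : ι → ℝ) (i : m) :
    Integrable (fun X : m → ι → ℝ => (X i ⬝ᵥ b) ^ 2) (Measure.pi fun _ => iidGaussian ι v) :=
  integrable_comp_eval (μ := fun _ => iidGaussian ι v) (i := i) (f := fun x => (x ⬝ᵥ b) ^ 2)
    (integrable_dotProduct_sq_iidGaussian v b)

theorem integrable_mulVec_dotProduct_self (v : ℝ≥0) (b : ι → ℝ) :
    Integrable (fun X : m → ι → ℝ => (of X *ᵥ b) ⬝ᵥ (of X *ᵥ b))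
      (Measure.pi fun _ => iidGaussian ι v) := by
  simp only [mulVec_dotProduct_self]
  exact integrable_finsetSum _ fun i _ => integrable_dotProduct_sq_row v b i

theorem integral_mulVec_dotProduct_self (v : ℝ≥0) (b : ι → ℝ) :
    ∫ X : m → ι → ℝ, (of X *ᵥ b) ⬝ᵥ (of X *ᵥ b) ∂(Measure.pi fun _ => iidGaussian ι v) =
      Fintype.card m * (v * (b ⬝ᵥ b)) := by
  have hrow (i : m) : ∫ X : m → ι → ℝ, (X i ⬝ᵥ b) ^ 2 ∂(Measure.pi fun _ => iidGaussian ι v) =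
      v * (b ⬝ᵥ b) :=
    (integral_comp_eval (μ := fun _ => iidGaussian ι v) (i := i) (f := fun x => (x ⬝ᵥ b) ^ 2)
      (integrable_dotProduct_sq_iidGaussian v b).aestronglyMeasurable).trans
      (integral_dotProduct_sq_iidGaussian v b)
  simp only [mulVec_dotProduct_self]
  rw [integral_finsetSum _ fun i _ => integrable_dotProduct_sq_row v b i]
  simp [hrow]

theorem integral_cexp_trace_mul_transpose (v : ℝ≥0) (C : Matrix m ι ℝ) :
    ∫ X : m → ι → ℝ, Complex.exp ((trace (of X * Cᵀ) : ℝ) * Complex.I)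
        ∂(Measure.pi fun _ => iidGaussian ι v) =
      Complex.exp (-(v * trace (C * Cᵀ) / 2 : ℝ)) := by
  have hrows (X : m → ι → ℝ) : Complex.exp ((trace (of X * Cᵀ) : ℝ) * Complex.I) =
      ∏ i, Complex.exp ((X i ⬝ᵥ C i : ℝ) * Complex.I) := by
    rw [← Complex.exp_sum, ← Finset.sum_mul, ← Complex.ofReal_sum]
    rfl
  simp only [hrows]
  rw [integral_fintype_prod_eq_prod
    (fun i (x : ι → ℝ) => Complex.exp ((x ⬝ᵥ C i : ℝ) * Complex.I))]
  simp only [integral_cexp_dotProduct_iidGaussian]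
  rw [← Complex.exp_sum, Finset.sum_neg_distrib, ← Complex.ofReal_sum, ← Finset.sum_div,
    ← Finset.mul_sum]
  rfl

theorem exists_eq_trace_mul_transpose (L : StrongDual ℝ (m → ι → ℝ)) :
    ∃ C : Matrix m ι ℝ, ∀ X, L X = trace (of X * Cᵀ) := by
  classical
  refine ⟨of fun i j => L (Pi.single i (Pi.single j 1)), fun X => ?_⟩
  have hX : X = ∑ i, ∑ j, X i j • (Pi.single i (Pi.single j (1 : ℝ)) : m → ι → ℝ) := by
    ext i j
    simp [Finset.sum_apply, Pi.single_apply, apply_ite, ite_apply]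
  conv_lhs => rw [hX]
  simp [map_sum, trace, mul_apply]

theorem map_glueRow [DecidableEq m] {P : Matrix m l ℝ} {u : m → ℝ}
    (hPu : P * Pᵀ + vecMulVec u u = 1) (c : ℝ≥0) :
    ((iidGaussian ι 1).prod (Measure.pi fun _ : l => iidGaussian ι 1)).map (glueRow c P u) =
      Measure.pi fun _ : m => iidGaussian ι (c ^ 2) := by
  have hmeas := measurable_glueRow (ι := ι) c P u
  have : IsProbabilityMeasure (((iidGaussian ι 1).prod
      (Measure.pi fun _ : l => iidGaussian ι 1)).map (glueRow c P u)) :=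
    Measure.isProbabilityMeasure_map hmeas.aemeasurable
  refine Measure.ext_of_charFunDual ?_
  ext L
  obtain ⟨C, hC⟩ := exists_eq_trace_mul_transpose L
  rw [charFunDual_apply, charFunDual_apply, integral_map hmeas.aemeasurable (by fun_prop)]
  simp only [hC, trace_glueRow_mul_transpose, integral_cexp_trace_mul_transpose,
    Complex.ofReal_add, add_mul, Complex.exp_add]
  rw [integral_prod_mul (fun g : ι → ℝ => Complex.exp ((g ⬝ᵥ (c : ℝ) • u ᵥ* C : ℝ) * Complex.I))
    (fun W : l → ι → ℝ => Complex.exp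
      ((trace (of W * ((c : ℝ) • (Pᵀ * C))ᵀ) : ℝ) * Complex.I)),
    integral_cexp_dotProduct_iidGaussian, integral_cexp_trace_mul_transpose, ← Complex.exp_add,
    ← dotProduct_add_trace_of_mul_transpose_add_vecMulVec_eq_one hPu C]
  congr 1
  simp only [smul_dotProduct, dotProduct_smul, transpose_smul, Matrix.smul_mul, Matrix.mul_smul,
    trace_smul, smul_eq_mul]
  push_cast
  ring

end IidGaussian

theorem ofReal_integral_le_lintegral {α : Type*} [MeasurableSpace α] {μ : Measure α} {f : α → ℝ}
    (hf : Integrable f μ) : ENNReal.ofReal (∫ x, f x ∂μ) ≤ ∫⁻ x, ENNReal.ofReal (f x) ∂μ := by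
  calc ENNReal.ofReal (∫ x, f x ∂μ) ≤ ENNReal.ofReal (∫ x, max (f x) 0 ∂μ) :=
        ENNReal.ofReal_le_ofReal (integral_mono hf hf.pos_part fun x => le_max_left _ _)
    _ = ∫⁻ x, ENNReal.ofReal (max (f x) 0) ∂μ :=
        ofReal_integral_eq_lintegral_ofReal hf.pos_part (ae_of_all _ fun x => le_max_right _ _)
    _ = ∫⁻ x, ENNReal.ofReal (f x) ∂μ := by simp [ENNReal.ofReal_max]

section Exceedance

variable {ι κ : Type*} [Fintype ι] [DecidableEq κ]

/-- The colours, under a colouring `c` of the coordinates, that occur among the coordinates of `g`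
exceeding `t`. Their number is a count of exceedances capped by the number of colours, with an
expectation that factors over the colour classes. -/
noncomputable def exceedanceColors (c : ι → κ) (t : ℝ) (g : ι → ℝ) : Finset κ :=
  ({j | t < g j} : Finset ι).image c

theorem mem_exceedanceColors {c : ι → κ} {t : ℝ} {g : ι → ℝ} {i : κ} :
    i ∈ exceedanceColors c t g ↔ ∃ j, t < g j ∧ c j = i := by
  simp [exceedanceColors]

theorem card_exceedanceColors_le (c : ι → κ) (t : ℝ) (g : ι → ℝ) :
    (exceedanceColors c t g).card ≤ ({j | t < g j} : Finset ι).card :=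
  Finset.card_image_le

theorem setOf_mem_exceedanceColors (c : ι → κ) (t : ℝ) (i : κ) :
    {g | i ∈ exceedanceColors c t g} =
      ((({j | c j = i} : Finset ι) : Set ι).pi fun _ => Set.Iic t)ᶜ := by
  ext g
  simp only [mem_exceedanceColors, Set.mem_ofPred_eq, Set.mem_compl_iff, Set.mem_pi,
    Finset.coe_filter, Finset.mem_univ, true_and, Set.mem_Iic, not_forall, not_le]
  exact exists_congr fun j => by rw [and_comm, exists_prop]

theorem measurableSet_mem_exceedanceColors (c : ι → κ) (t : ℝ) (i : κ) :
    MeasurableSet {g | i ∈ exceedanceColors c t g} := by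
  rw [setOf_mem_exceedanceColors]
  exact (MeasurableSet.pi (Finset.countable_toSet _) fun _ _ => measurableSet_Iic).compl

theorem measureReal_mem_exceedanceColors (ν : Measure ℝ) [IsProbabilityMeasure ν] (c : ι → κ)
    (t : ℝ) (i : κ) :
    (Measure.pi fun _ : ι => ν).real {g | i ∈ exceedanceColors c t g} =
      1 - (1 - ν.real (Set.Ioi t)) ^ ({j | c j = i} : Finset ι).card := by
  have hIic : ν.real (Set.Iic t) = 1 - ν.real (Set.Ioi t) := by
    rw [← Set.compl_Ioi, probReal_compl_eq_one_sub measurableSet_Ioi]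
  rw [setOf_mem_exceedanceColors, probReal_compl_eq_one_sub
    (MeasurableSet.pi (Finset.countable_toSet _) fun _ _ => measurableSet_Iic), measureReal_def,
    Measure.pi_pi_finset, ENNReal.toReal_prod, Finset.prod_const, ← measureReal_def, hIic]

theorem card_exceedanceColors_eq_sum [Fintype κ] (c : ι → κ) (t : ℝ) (g : ι → ℝ) :
    ((exceedanceColors c t g).card : ℝ) =
      ∑ i, {g | i ∈ exceedanceColors c t g}.indicator (fun _ => (1 : ℝ)) g := by
  simp [Set.indicator_apply]

theorem integrable_card_exceedanceColors [Finite κ] (ν : Measure ℝ) [IsProbabilityMeasure ν]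
    (c : ι → κ) (t : ℝ) :
    Integrable (fun g => ((exceedanceColors c t g).card : ℝ)) (Measure.pi fun _ : ι => ν) := by
  cases nonempty_fintype κ
  simp only [card_exceedanceColors_eq_sum]
  exact integrable_finsetSum _ fun i _ =>
    (integrable_const 1).indicator (measurableSet_mem_exceedanceColors c t i)

variable [Fintype κ]

theorem integral_card_exceedanceColors (ν : Measure ℝ) [IsProbabilityMeasure ν] (c : ι → κ)
    (t : ℝ) :
    ∫ g, ((exceedanceColors c t g).card : ℝ) ∂(Measure.pi fun _ : ι => ν) =
      ∑ i, (1 - (1 - ν.real (Set.Ioi t)) ^ ({j | c j = i} : Finset ι).card) := by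
  simp only [card_exceedanceColors_eq_sum]
  rw [integral_finsetSum _ fun i _ =>
    (integrable_const (1 : ℝ)).indicator (measurableSet_mem_exceedanceColors c t i)]
  refine Finset.sum_congr rfl fun i _ => ?_
  exact (integral_indicator_one (measurableSet_mem_exceedanceColors c t i)).trans
    (measureReal_mem_exceedanceColors ν c t i)

theorem card_div_three_le_integral_card_exceedanceColors (ν : Measure ℝ) [IsProbabilityMeasure ν]
    {c : ι → κ} {t : ℝ} {m : ℕ} (hm : ∀ i, m ≤ ({j | c j = i} : Finset ι).card)
    (hmt : 1 / 2 ≤ m * ν.real (Set.Ioi t)) :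
    Fintype.card κ / 3 ≤ ∫ g, ((exceedanceColors c t g).card : ℝ) ∂(Measure.pi fun _ : ι => ν) := by
  set q := ν.real (Set.Ioi t)
  have hq0 : 0 ≤ q := measureReal_nonneg
  have hq1 : 0 ≤ 1 - q := sub_nonneg.2 measureReal_le_one
  have hexp : Real.exp (-(1 / 2)) ≤ 2 / 3 := by
    rw [Real.exp_neg, inv_le_comm₀ (Real.exp_pos _) (by norm_num)]
    linarith [Real.add_one_le_exp (1 / 2 : ℝ)]
  have hclass (i : κ) : (1 - q) ^ ({j | c j = i} : Finset ι).card ≤ 2 / 3 := calc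
    _ ≤ (1 - q) ^ m := pow_le_pow_of_le_one hq1 (by linarith) (hm i)
    _ ≤ Real.exp (-q) ^ m := by gcongr; exact Real.one_sub_le_exp_neg q
    _ = Real.exp (-(m * q)) := by rw [← Real.exp_nat_mul]; ring_nf
    _ ≤ 2 / 3 := (Real.exp_le_exp.2 (by linarith)).trans hexp
  rw [integral_card_exceedanceColors]
  calc (Fintype.card κ : ℝ) / 3 = ∑ _ : κ, (1 - 2 / 3 : ℝ) := by
        rw [Finset.sum_const, Finset.card_univ, nsmul_eq_mul]
        ring
    _ ≤ _ := Finset.sum_le_sum fun i _ => by linarith [hclass i]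

theorem exists_coloring_div_le_card {p k : ℕ} (hk : 0 < k) :
    ∃ c : Fin p → Fin k, ∀ i, p / k ≤ ({j | c j = i} : Finset (Fin p)).card := by
  refine ⟨fun j => ⟨j % k, Nat.mod_lt _ hk⟩, fun i => ?_⟩
  have hlt (r : Fin (p / k)) : k * r + i < p := calc
    k * r + i < k * (r + 1) := by rw [mul_add_one]; omega
    _ ≤ k * (p / k) := Nat.mul_le_mul_left k r.isLt
    _ ≤ p := Nat.mul_div_le p k
  calc p / k = (Finset.univ : Finset (Fin (p / k))).card := by simp
    _ ≤ _ := Finset.card_le_card_of_injOn (fun r => ⟨k * r + i, hlt r⟩)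
      (fun r _ => by simp [Fin.ext_iff, Nat.mod_eq_of_lt i.isLt])
      (fun r _ s _ h => by simpa [Fin.ext_iff, hk.ne'] using h)

theorem exp_neg_le_gaussianReal_Ioi_sqrt {L : ℝ} (hL : 4 ≤ L) :
    Real.exp (-L) ≤ (gaussianReal 0 1).real (Set.Ioi √(L / 2)) := by
  have hpi : √(2 * Real.pi) ≤ Real.exp 1 := by
    rw [Real.sqrt_le_left (Real.exp_pos 1).le]
    nlinarith [Real.pi_lt_d2, Real.exp_one_gt_d9]
  refine le_trans ?_ (exp_div_le_gaussianReal_Ioi (Real.sqrt_nonneg _))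
  rw [Real.sq_sqrt (by linarith), le_div_iff₀ (by positivity)]
  calc Real.exp (-L) * √(2 * Real.pi) ≤ Real.exp (-L) * Real.exp 1 := by gcongr
    _ = Real.exp (-L + 1) := by rw [Real.exp_add]
    _ ≤ Real.exp (-(L / 2) - 1) := Real.exp_le_exp.2 (by linarith)

theorem exists_coloring_div_three_le_integral {p k : ℕ} (hk : 1 ≤ k) (hkp : k ≤ p)
    (hL : 4 ≤ Real.log (p / k)) :
    ∃ c : Fin p → Fin k, k / 3 ≤ ∫ g, ((exceedanceColors c √(Real.log (p / k) / 2) g).card : ℝ)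
      ∂(iidGaussian (Fin p) 1) := by
  have hk0 : (0 : ℝ) < k := by exact_mod_cast hk
  have hp0 : (0 : ℝ) < p := by exact_mod_cast hk.trans hkp
  obtain ⟨c, hc⟩ := exists_coloring_div_le_card (p := p) hk
  refine ⟨c, ?_⟩
  conv_lhs => rw [← Fintype.card_fin k]
  refine card_div_three_le_integral_card_exceedanceColors (gaussianReal 0 1) hc ?_
  have hdiv : (p / k : ℝ) ≤ 2 * (p / k : ℕ) := by
    have hlt : p < k * (p / k + 1) := Nat.lt_mul_div_succ p hk
    have hone : 1 ≤ p / k := Nat.div_pos hkp hk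
    rw [div_le_iff₀ hk0]
    exact_mod_cast (show p ≤ 2 * (p / k) * k by nlinarith)
  have htail := exp_neg_le_gaussianReal_Ioi_sqrt hL
  rw [Real.exp_neg, Real.exp_log (by positivity)] at htail
  calc (1 / 2 : ℝ) = (p / k) / 2 * (p / k : ℝ)⁻¹ := by field_simp
    _ ≤ (p / k : ℕ) * (gaussianReal 0 1).real (Set.Ioi √(Real.log (p / k) / 2)) := by
        gcongr
        linarith

end Exceedance

section SparseEnergy

variable {ι : Type*} [Fintype ι]

/-- A bound for the sum of the squares of any `k` entries of `g`. It has expectation of the right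
order `k L` when the entries are i.i.d. standard Gaussian and `L` is the logarithm of their number
divided by `k`. -/
noncomputable def sparseEnergyBound (k : ℕ) (L : ℝ) (g : ι → ℝ) : ℝ :=
  4 * k * L + 4 * Real.exp (-L) * ∑ j, Real.exp (g j ^ 2 / 4)

theorem sum_sq_le_sparseEnergyBound {k : ℕ} {L : ℝ} (hL : 0 ≤ L) (g : ι → ℝ) {S : Finset ι}
    (hS : S.card ≤ k) : ∑ j ∈ S, g j ^ 2 ≤ sparseEnergyBound k L g := by
  have hsq (x : ℝ) : x ^ 2 ≤ 4 * L + 4 * Real.exp (-L) * Real.exp (x ^ 2 / 4) := by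
    rw [mul_assoc, ← Real.exp_add]
    linarith [Real.add_one_le_exp (-L + x ^ 2 / 4)]
  calc ∑ j ∈ S, g j ^ 2
      ≤ ∑ j ∈ S, (4 * L + 4 * Real.exp (-L) * Real.exp (g j ^ 2 / 4)) :=
        Finset.sum_le_sum fun j _ => hsq _
    _ = 4 * S.card * L + 4 * Real.exp (-L) * ∑ j ∈ S, Real.exp (g j ^ 2 / 4) := by
        rw [Finset.sum_add_distrib, Finset.sum_const, nsmul_eq_mul, ← Finset.mul_sum]
        ring
    _ ≤ sparseEnergyBound k L g := by
        unfold sparseEnergyBound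
        gcongr
        exact Finset.subset_univ S

theorem integrable_exp_sq_div_four_eval (i : ι) :
    Integrable (fun g : ι → ℝ => Real.exp (g i ^ 2 / 4)) (iidGaussian ι 1) :=
  integrable_comp_eval (μ := fun _ => gaussianReal 0 1) (i := i)
    (f := fun x => Real.exp (x ^ 2 / 4)) integrable_exp_sq_div_four

theorem integrable_sparseEnergyBound (k : ℕ) (L : ℝ) :
    Integrable (sparseEnergyBound k L) (iidGaussian ι 1) :=
  (integrable_const _).add
    ((integrable_finsetSum _ fun i _ => integrable_exp_sq_div_four_eval i).const_mul _)

theorem integral_sparseEnergyBound (k : ℕ) (L : ℝ) :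
    ∫ g, sparseEnergyBound k L g ∂(iidGaussian ι 1) =
      4 * k * L + 4 * Real.exp (-L) * (Fintype.card ι * √2) := by
  have hcoord (i : ι) : ∫ g, Real.exp (g i ^ 2 / 4) ∂(iidGaussian ι 1) = √2 :=
    (integral_comp_eval (μ := fun _ => gaussianReal 0 1) (i := i)
      (f := fun x => Real.exp (x ^ 2 / 4))
      integrable_exp_sq_div_four.aestronglyMeasurable).trans integral_exp_sq_div_four
  have hint : Integrable (fun g : ι → ℝ => ∑ i, Real.exp (g i ^ 2 / 4)) (iidGaussian ι 1) :=
    integrable_finsetSum _ fun i _ => integrable_exp_sq_div_four_eval i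
  unfold sparseEnergyBound
  rw [integral_add (integrable_const _) (hint.const_mul _), integral_const, integral_const_mul,
    integral_finsetSum _ fun i _ => integrable_exp_sq_div_four_eval i]
  simp [hcoord]

theorem integral_sparseEnergyBound_log_le {p k : ℕ} (hk : 1 ≤ k) (hkp : k ≤ p)
    (hL : 4 ≤ Real.log (p / k)) :
    ∫ g, sparseEnergyBound k (Real.log (p / k)) g ∂(iidGaussian (Fin p) 1) ≤
      6 * (k * Real.log (p / k)) := by
  have hk0 : (0 : ℝ) < k := by exact_mod_cast hk
  have hp0 : (0 : ℝ) < p := by exact_mod_cast hk.trans hkp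
  have hsqrt : √2 ≤ 2 := by norm_num [Real.sqrt_le_left]
  rw [integral_sparseEnergyBound, Fintype.card_fin]
  calc 4 * k * Real.log (p / k) + 4 * Real.exp (-Real.log (p / k)) * (p * √2)
      = 4 * k * Real.log (p / k) + 4 * k * √2 := by
        rw [Real.exp_neg, Real.exp_log (div_pos hp0 hk0)]
        field_simp
    _ ≤ 4 * k * Real.log (p / k) + k * (2 * Real.log (p / k)) := by
        nlinarith
    _ = 6 * (k * Real.log (p / k)) := by ring

end SparseEnergy

section Regression

variable {n p k : ℕ} {δ : Estimator n p}

theorem predict_eq_mulVec (x : Design n p) (b : EuclideanSpace ℝ (Fin p)) :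
    predict x b = of x *ᵥ b.ofLp :=
  rfl

theorem rss_eq (d : Design n p × (Fin n → ℝ)) (b : EuclideanSpace ℝ (Fin p)) :
    rss d b = d.2 ⬝ᵥ d.2 - 2 * ((d.2 ᵥ* of d.1) ⬝ᵥ b.ofLp) + predict d.1 b ⬝ᵥ predict d.1 b := by
  rw [← dotProduct_mulVec, ← predict_eq_mulVec]
  simp only [rss, dotProduct, Finset.mul_sum, ← Finset.sum_add_distrib, ← Finset.sum_sub_distrib]
  exact Finset.sum_congr rfl fun i _ => by ring

theorem IsBestSubsetSelection.two_mul_dotProduct_sub_le (hδ : IsBestSubsetSelection k δ)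
    (d : Design n p × (Fin n → ℝ)) {b : EuclideanSpace ℝ (Fin p)} (hb : l0 b ≤ k) :
    2 * ((d.2 ᵥ* of d.1) ⬝ᵥ b.ofLp) - predict d.1 b ⬝ᵥ predict d.1 b ≤
      2 * ((d.2 ᵥ* of d.1) ⬝ᵥ (δ d).ofLp) := by
  have hrss := (hδ d).2 b hb
  have hfit : 0 ≤ predict d.1 (δ d) ⬝ᵥ predict d.1 (δ d) :=
    Finset.sum_nonneg fun i _ => mul_self_nonneg _
  rw [rss_eq, rss_eq] at hrss
  linarith

theorem two_mul_dotProduct_le_of_l0_le {L lam : ℝ} (hL : 0 ≤ L) (hlam : 0 < lam) (κ : ℝ)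
    (g : Fin p → ℝ) {v : EuclideanSpace ℝ (Fin p)} (hv : l0 v ≤ k) :
    2 * (κ * (g ⬝ᵥ v.ofLp)) ≤ lam * ‖v‖ ^ 2 + κ ^ 2 / lam * sparseEnergyBound k L g := by
  set S : Finset (Fin p) := {j | v j ≠ 0}
  have hsupp : g ⬝ᵥ v.ofLp = ∑ j ∈ S, g j * v j :=
    (Finset.sum_subset (Finset.subset_univ S) fun j _ hj => by simp_all [S]).symm
  have hyoung (j : Fin p) : 2 * (κ * (g j * v j)) ≤ lam * v j ^ 2 + κ ^ 2 / lam * g j ^ 2 := by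
    have hsq : lam * v j ^ 2 + κ ^ 2 / lam * g j ^ 2 - 2 * (κ * (g j * v j)) =
        lam * (v j - κ / lam * g j) ^ 2 := by
      field_simp
      ring
    have := mul_nonneg hlam.le (sq_nonneg (v j - κ / lam * g j))
    linarith
  calc 2 * (κ * (g ⬝ᵥ v.ofLp)) = ∑ j ∈ S, 2 * (κ * (g j * v j)) := by
        rw [hsupp, Finset.mul_sum, Finset.mul_sum]
    _ ≤ ∑ j ∈ S, (lam * v j ^ 2 + κ ^ 2 / lam * g j ^ 2) := Finset.sum_le_sum fun j _ => hyoung j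
    _ = lam * ∑ j ∈ S, v j ^ 2 + κ ^ 2 / lam * ∑ j ∈ S, g j ^ 2 := by
        rw [Finset.sum_add_distrib, Finset.mul_sum, Finset.mul_sum]
    _ ≤ lam * ‖v‖ ^ 2 + κ ^ 2 / lam * sparseEnergyBound k L g := by
        rw [EuclideanSpace.real_norm_sq_eq]
        gcongr
        · exact Finset.subset_univ S
        · exact sum_sq_le_sparseEnergyBound hL g hv

theorem IsBestSubsetSelection.sub_le_mul_norm_sq (hδ : IsBestSubsetSelection k δ)
    {d : Design n p × (Fin n → ℝ)} {κ : ℝ} {g : Fin p → ℝ} (hd : d.2 ᵥ* of d.1 = κ • g)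
    {L lam : ℝ} (hL : 0 ≤ L) (hlam : 0 < lam) {b : EuclideanSpace ℝ (Fin p)} (hb : l0 b ≤ k) :
    2 * (κ * (g ⬝ᵥ b.ofLp)) - predict d.1 b ⬝ᵥ predict d.1 b -
      κ ^ 2 / lam * sparseEnergyBound k L g ≤ lam * ‖δ d‖ ^ 2 := by
  have hgain := hδ.two_mul_dotProduct_sub_le d hb
  simp only [hd, smul_dotProduct, smul_eq_mul] at hgain
  linarith [two_mul_dotProduct_le_of_l0_le hL hlam κ g (hδ d).1]

theorem exists_dotProduct_eq_of_forall_lt {t : ℝ} (ht : 0 ≤ t) {g : Fin p → ℝ}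
    {S : Finset (Fin p)} (hS : ∀ j ∈ S, t < g j) (c : ℝ) :
    ∃ b : EuclideanSpace ℝ (Fin p), l0 b ≤ S.card ∧ b.ofLp ⬝ᵥ b.ofLp ≤ c ^ 2 * S.card ∧
      g ⬝ᵥ b.ofLp = c * t * S.card := by
  have hpos {j} (hj : j ∈ S) : 0 < g j := ht.trans_lt (hS j hj)
  refine ⟨WithLp.toLp 2 fun j => if j ∈ S then c * (t / g j) else 0, ?_, ?_, ?_⟩
  · exact Finset.card_le_card fun j hj => by by_contra hjS; simp [hjS] at hj
  · calc _ = ∑ j ∈ S, c ^ 2 * (t / g j) ^ 2 := by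
          simp [dotProduct, mul_pow, ← sq]
      _ ≤ ∑ _ ∈ S, c ^ 2 * 1 := by
          gcongr with j hj
          have := hpos hj
          exact pow_le_one₀ (by positivity) ((div_le_one this).2 (hS j hj).le)
      _ = c ^ 2 * S.card := by simp [mul_comm]
  · calc _ = ∑ j ∈ S, g j * (c * (t / g j)) := by simp [dotProduct]
      _ = ∑ _ ∈ S, c * t := Finset.sum_congr rfl fun j hj => by
          have := (hpos hj).ne'
          field_simp
      _ = c * t * S.card := by simp [mul_comm]

theorem exists_l0_le_dotProduct_eq {t : ℝ} (ht : 0 ≤ t) (c : ℝ) (col : Fin p → Fin k)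
    (g : Fin p → ℝ) :
    ∃ b : EuclideanSpace ℝ (Fin p), l0 b ≤ k ∧
      b.ofLp ⬝ᵥ b.ofLp ≤ c ^ 2 * (exceedanceColors col t g).card ∧
      g ⬝ᵥ b.ofLp = c * t * (exceedanceColors col t g).card := by
  obtain ⟨S, hSsub, hScard⟩ := Finset.exists_subset_card_eq (card_exceedanceColors_le col t g)
  obtain ⟨b, hl0, hsq, hdot⟩ :=
    exists_dotProduct_eq_of_forall_lt ht (fun j hj => (Finset.mem_filter.1 (hSsub hj)).2) c
  rw [hScard] at hl0 hsq hdot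
  exact ⟨b, hl0.trans (card_finset_fin_le _), hsq, hdot⟩

end Regression

section ConditionalDesign

variable {n p : ℕ} {u : Fin n → ℝ}

/-- The design matrix with `uᵀ X = gᵀ / √n` and with the component of the columns orthogonal to `u`
taken from `W / √n`, where `w = (g, W)`. At `β = 0` it has, for i.i.d. standard Gaussian `g` and
`W`, the conditional law of `X` given `y`, and `g` determines the correlations `Xᵀ y` when `u` is
`y` normalized. -/
noncomputable def conditionalDesign (u : Fin n → ℝ) (w : (Fin p → ℝ) × (Fin n → Fin p → ℝ)) :
    Design n p :=
  glueRow (√n)⁻¹ (1 - vecMulVec u u) u w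

theorem measurable_conditionalDesign (u : Fin n → ℝ) :
    Measurable (conditionalDesign u : (Fin p → ℝ) × (Fin n → Fin p → ℝ) → Design n p) :=
  measurable_glueRow _ _ _

theorem map_conditionalDesign (hu : u ⬝ᵥ u = 1) :
    ((iidGaussian (Fin p) 1).prod (Measure.pi fun _ => iidGaussian (Fin p) 1)).map
      (conditionalDesign u) = designLaw n p := by
  have hproj : (1 - vecMulVec u u) * (1 - vecMulVec u u)ᵀ + vecMulVec u u = 1 := by
    simp [Matrix.sub_mul, Matrix.mul_sub, transpose_vecMulVec, vecMulVec_mul_vecMulVec, hu]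
  have hvar : ((NNReal.sqrt n)⁻¹) ^ 2 = (1 / n : ℝ≥0) := by rw [inv_pow, NNReal.sq_sqrt, one_div]
  have hmap := map_glueRow (ι := Fin p) hproj (NNReal.sqrt n)⁻¹
  rwa [hvar, NNReal.coe_inv, Real.coe_sqrt, NNReal.coe_natCast] at hmap

theorem vecMul_conditionalDesign (hu : u ⬝ᵥ u = 1) (w : (Fin p → ℝ) × (Fin n → Fin p → ℝ)) :
    u ᵥ* of (conditionalDesign u w) = (√n)⁻¹ • w.1 := by
  rw [conditionalDesign, glueRow, Equiv.apply_symm_apply, vecMul_smul, vecMul_add, ← vecMul_vecMul,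
    vecMul_sub, vecMul_one, vecMul_vecMulVec, vecMul_vecMulVec, hu, one_smul, one_smul, sub_self,
    zero_vecMul, zero_add]

theorem predict_conditionalDesign_dotProduct_self_le (hu : u ⬝ᵥ u = 1)
    (w : (Fin p → ℝ) × (Fin n → Fin p → ℝ)) (b : EuclideanSpace ℝ (Fin p)) :
    predict (conditionalDesign u w) b ⬝ᵥ predict (conditionalDesign u w) b ≤
      ((of w.2 *ᵥ b.ofLp) ⬝ᵥ (of w.2 *ᵥ b.ofLp) + (w.1 ⬝ᵥ b.ofLp) ^ 2) / n := by
  set z := of w.2 *ᵥ b.ofLp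
  set h := w.1 ⬝ᵥ b.ofLp
  have hpredict : predict (conditionalDesign u w) b = (√n)⁻¹ • (z + (h - u ⬝ᵥ z) • u) := by
    rw [predict_eq_mulVec, conditionalDesign, glueRow, Equiv.apply_symm_apply, smul_mulVec,
      add_mulVec, ← mulVec_mulVec, sub_mulVec, one_mulVec, vecMulVec_mulVec, vecMulVec_mulVec]
    simp only [op_smul_eq_smul, sub_smul]
    congr 1
    exact sub_add_eq_add_sub _ _ _ |>.trans (add_sub_assoc _ _ _)
  have hnorm : (z + (h - u ⬝ᵥ z) • u) ⬝ᵥ (z + (h - u ⬝ᵥ z) • u) =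
      z ⬝ᵥ z + h ^ 2 - (u ⬝ᵥ z) ^ 2 := by
    simp only [add_dotProduct, dotProduct_add, smul_dotProduct, dotProduct_smul, hu,
      dotProduct_comm z u, smul_eq_mul]
    ring
  rw [hpredict, smul_dotProduct, dotProduct_smul, hnorm, smul_smul, ← mul_inv,
    Real.mul_self_sqrt n.cast_nonneg, smul_eq_mul, inv_mul_eq_div]
  gcongr
  linarith [sq_nonneg (u ⬝ᵥ z)]

end ConditionalDesign

section Risk

variable {n p k : ℕ} {δ : Estimator n p}

theorem IsBestSubsetSelection.ofReal_le_lintegral_conditionalDesign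
    (hδ : IsBestSubsetSelection k δ) {u : Fin n → ℝ} (hu : u ⬝ᵥ u = 1) (ρ : ℝ) (g : Fin p → ℝ)
    {L lam : ℝ} (hL : 0 ≤ L) (hlam : 0 < lam) {b : EuclideanSpace ℝ (Fin p)} (hb : l0 b ≤ k) :
    ENNReal.ofReal (2 * (ρ / √n * (g ⬝ᵥ b.ofLp)) - (b.ofLp ⬝ᵥ b.ofLp + (g ⬝ᵥ b.ofLp) ^ 2 / n) -
        (ρ / √n) ^ 2 / lam * sparseEnergyBound k L g) ≤
      ∫⁻ W, ENNReal.ofReal (lam * ‖δ (conditionalDesign u (g, W), ρ • u)‖ ^ 2)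
        ∂(Measure.pi fun _ => iidGaussian (Fin p) 1) := by
  have hn : (n : ℝ) ≠ 0 := by rintro hn; obtain rfl := Nat.cast_eq_zero.1 hn; simp at hu
  set a := 2 * (ρ / √n * (g ⬝ᵥ b.ofLp)) - (g ⬝ᵥ b.ofLp) ^ 2 / n -
    (ρ / √n) ^ 2 / lam * sparseEnergyBound k L g with ha
  have hint := (integrable_mulVec_dotProduct_self (m := Fin n) 1 b.ofLp).div_const n
  have hmean : ∫ W : Fin n → Fin p → ℝ, (a - (of W *ᵥ b.ofLp) ⬝ᵥ (of W *ᵥ b.ofLp) / n)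
      ∂(Measure.pi fun _ => iidGaussian (Fin p) 1) = a - b.ofLp ⬝ᵥ b.ofLp := by
    rw [integral_sub (integrable_const a) hint, integral_div, integral_mulVec_dotProduct_self]
    simp [mul_div_cancel_left₀ _ hn]
  calc _ = ENNReal.ofReal (a - b.ofLp ⬝ᵥ b.ofLp) := by rw [ha]; ring_nf
    _ ≤ ∫⁻ W : Fin n → Fin p → ℝ, ENNReal.ofReal (a - (of W *ᵥ b.ofLp) ⬝ᵥ (of W *ᵥ b.ofLp) / n)
        ∂(Measure.pi fun _ => iidGaussian (Fin p) 1) := by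
      rw [← hmean]
      exact ofReal_integral_le_lintegral ((integrable_const a).sub hint)
    _ ≤ _ := lintegral_mono fun W => ENNReal.ofReal_le_ofReal ?_
  have hcorr : (ρ • u) ᵥ* of (conditionalDesign u (g, W)) = (ρ / √n) • g := by
    rw [smul_vecMul, vecMul_conditionalDesign hu, smul_smul, div_eq_mul_inv]
  have hfit := predict_conditionalDesign_dotProduct_self_le hu (g, W) b
  rw [add_div] at hfit
  linarith [hδ.sub_le_mul_norm_sq (d := (conditionalDesign u (g, W), ρ • u)) hcorr hL hlam hb]

theorem IsBestSubsetSelection.ofReal_card_exceedanceColors_le_lintegral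
    (hδ : IsBestSubsetSelection k δ) {u : Fin n → ℝ} (hu : u ⬝ᵥ u = 1) (ρ : ℝ) (g : Fin p → ℝ)
    {L lam t D : ℝ} (hL : 0 ≤ L) (hlam : 0 < lam) (ht : 0 ≤ t) (hD : 1 + t ^ 2 * k / n ≤ D)
    (col : Fin p → Fin k) :
    ENNReal.ofReal ((ρ / √n) ^ 2 * (t ^ 2 / D * (exceedanceColors col t g).card -
        lam⁻¹ * sparseEnergyBound k L g)) ≤
      ∫⁻ W, ENNReal.ofReal (lam * ‖δ (conditionalDesign u (g, W), ρ • u)‖ ^ 2)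
        ∂(Measure.pi fun _ => iidGaussian (Fin p) 1) := by
  have hD0 : 0 < D := lt_of_lt_of_le (by positivity) hD
  set κ := ρ / √n
  set N := (exceedanceColors col t g).card
  -- The scale `κ t / D` maximizes `c ↦ 2 κ c t - c ^ 2 D`.
  obtain ⟨b, hb, hbsq, hgb⟩ := exists_l0_le_dotProduct_eq ht (κ * t / D) col g
  refine le_trans (ENNReal.ofReal_le_ofReal ?_)
    (hδ.ofReal_le_lintegral_conditionalDesign hu ρ g hL hlam hb)
  have hNk : (N : ℝ) ≤ k := by exact_mod_cast card_finset_fin_le _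
  have hcost : b.ofLp ⬝ᵥ b.ofLp + (g ⬝ᵥ b.ofLp) ^ 2 / n ≤ (κ * t / D) ^ 2 * N * D := calc
    _ ≤ (κ * t / D) ^ 2 * N + (κ * t / D * t * N) ^ 2 / n := by rw [hgb]; gcongr
    _ = (κ * t / D) ^ 2 * N * (1 + t ^ 2 * N / n) := by ring
    _ ≤ (κ * t / D) ^ 2 * N * D := by
      gcongr
      exact le_trans (by gcongr) hD
  calc κ ^ 2 * (t ^ 2 / D * N - lam⁻¹ * sparseEnergyBound k L g)
      = 2 * (κ * (κ * t / D * t * N)) - (κ * t / D) ^ 2 * N * D -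
          κ ^ 2 / lam * sparseEnergyBound k L g := by
        field_simp
        ring
    _ ≤ 2 * (κ * (g ⬝ᵥ b.ofLp)) - (b.ofLp ⬝ᵥ b.ofLp + (g ⬝ᵥ b.ofLp) ^ 2 / n) -
          κ ^ 2 / lam * sparseEnergyBound k L g := by rw [hgb] at hcost ⊢; linarith

theorem lintegral_conditionalDesign {u : Fin n → ℝ} (hu : u ⬝ᵥ u = 1)
    {f : Design n p → ℝ≥0∞} (hf : Measurable f) :
    ∫⁻ g, ∫⁻ W, f (conditionalDesign u (g, W)) ∂(Measure.pi fun _ => iidGaussian (Fin p) 1)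
      ∂(iidGaussian (Fin p) 1) = ∫⁻ x, f x ∂(designLaw n p) := by
  rw [← map_conditionalDesign hu, lintegral_map hf (measurable_conditionalDesign u)]
  exact (lintegral_prod _ (hf.comp (measurable_conditionalDesign u)).aemeasurable).symm

theorem exists_coloring_div_le_integral_card_sub_sparseEnergyBound (hk : 1 ≤ k) (hkp : k ≤ p)
    (hL : 4 ≤ Real.log (p / k)) {D : ℝ} (hD : 0 < D) :
    ∃ col : Fin p → Fin k, k * Real.log (p / k) / (12 * D) ≤
      ∫ g, (√(Real.log (p / k) / 2) ^ 2 / D *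
          (exceedanceColors col √(Real.log (p / k) / 2) g).card -
        (72 * D)⁻¹ * sparseEnergyBound k (Real.log (p / k)) g) ∂(iidGaussian (Fin p) 1) := by
  set L := Real.log (p / k)
  have hL0 : 0 ≤ L := by linarith
  obtain ⟨col, hcol⟩ := exists_coloring_div_three_le_integral hk hkp hL
  have hcard := integrable_card_exceedanceColors (gaussianReal 0 1) col √(L / 2)
  have henergy := integrable_sparseEnergyBound (ι := Fin p) k L
  refine ⟨col, ?_⟩
  rw [integral_sub (hcard.const_mul _) (henergy.const_mul _), integral_const_mul,
    integral_const_mul, Real.sq_sqrt (div_nonneg hL0 zero_le_two)]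
  -- The weight `(72 * D)⁻¹` makes the energy term half of the exceedance term.
  calc k * L / (12 * D) = L / 2 / D * (k / 3) - (72 * D)⁻¹ * (6 * (k * L)) := by
        field_simp
        ring
    _ ≤ _ := by
        gcongr
        exact integral_sparseEnergyBound_log_le hk hkp hL

theorem IsBestSubsetSelection.ofReal_le_lintegral_designLaw_of_dotProduct_eq_one
    (hδ : IsBestSubsetSelection k δ) (hδm : Measurable δ) (hk : 1 ≤ k) (hkp : k ≤ p)
    (hL : 4 ≤ Real.log (p / k)) {u : Fin n → ℝ} (hu : u ⬝ᵥ u = 1) (ρ : ℝ) :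
    ENNReal.ofReal (ρ ^ 2 / n *
        (k * Real.log (p / k) / (864 * (1 + k * Real.log (p / k) / n) ^ 2))) ≤
      ∫⁻ x, ENNReal.ofReal (‖δ (x, ρ • u)‖ ^ 2) ∂(designLaw n p) := by
  set L := Real.log (p / k)
  set D := 1 + k * L / n
  have hL0 : 0 ≤ L := by linarith
  have hD0 : 0 < D := by positivity
  have hDt : 1 + √(L / 2) ^ 2 * k / n ≤ D := by
    rw [Real.sq_sqrt (by positivity)]
    simp only [D, mul_comm (k : ℝ) L]
    gcongr
    linarith
  obtain ⟨col, hmean⟩ := exists_coloring_div_le_integral_card_sub_sparseEnergyBound hk hkp hL hD0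
  have hcard := integrable_card_exceedanceColors (gaussianReal 0 1) col √(L / 2)
  have henergy := integrable_sparseEnergyBound (ι := Fin p) k L
  have hδmeas : Measurable fun x : Design n p => ENNReal.ofReal (72 * D * ‖δ (x, ρ • u)‖ ^ 2) :=
    (((hδm.comp (measurable_id.prodMk measurable_const)).norm.pow_const 2).const_mul
      (72 * D)).ennreal_ofReal
  have hweighted : ENNReal.ofReal (72 * D) *
      ENNReal.ofReal (ρ ^ 2 / n * (k * L / (864 * D ^ 2))) ≤
        ENNReal.ofReal (72 * D) * ∫⁻ x, ENNReal.ofReal (‖δ (x, ρ • u)‖ ^ 2) ∂(designLaw n p) := by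
    calc _ = ENNReal.ofReal ((ρ / √n) ^ 2 * (k * L / (12 * D))) := by
          rw [← ENNReal.ofReal_mul (by positivity), div_pow, Real.sq_sqrt n.cast_nonneg]
          congr 1
          field_simp
          ring
      _ ≤ _ := ENNReal.ofReal_le_ofReal (mul_le_mul_of_nonneg_left hmean (sq_nonneg _))
      _ ≤ _ := by
          rw [← integral_const_mul]
          exact ofReal_integral_le_lintegral
            (((hcard.const_mul _).sub (henergy.const_mul _)).const_mul _)
      _ ≤ _ := lintegral_mono fun g => hδ.ofReal_card_exceedanceColors_le_lintegral hu ρ g hL0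
          (by positivity) (Real.sqrt_nonneg _) hDt col
      _ = _ := lintegral_conditionalDesign hu hδmeas
      _ = _ := by
          simp only [ENNReal.ofReal_mul (show 0 ≤ 72 * D by positivity)]
          exact lintegral_const_mul' _ _ ENNReal.ofReal_ne_top
  exact (ENNReal.mul_le_mul_iff_right (by simpa using hD0) ENNReal.ofReal_ne_top).1 hweighted

end Risk

section WorstRisk

variable {n p k : ℕ} {δ : Estimator n p}

theorem IsBestSubsetSelection.ofReal_le_lintegral_designLaw (hδ : IsBestSubsetSelection k δ)
    (hδm : Measurable δ) (hk : 1 ≤ k) (hkp : k ≤ p) (hL : 4 ≤ Real.log (p / k))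
    (y : Fin n → ℝ) :
    ENNReal.ofReal (y ⬝ᵥ y / n *
        (k * Real.log (p / k) / (864 * (1 + k * Real.log (p / k) / n) ^ 2))) ≤
      ∫⁻ x, ENNReal.ofReal (‖δ (x, y)‖ ^ 2) ∂(designLaw n p) := by
  rcases eq_or_ne y 0 with rfl | hy
  · simp
  have hyy : 0 < y ⬝ᵥ y := by simpa using dotProduct_star_self_pos_iff.2 hy
  set ρ := √(y ⬝ᵥ y)
  have hρ : 0 < ρ := Real.sqrt_pos.2 hyy
  have hρsq : ρ ^ 2 = y ⬝ᵥ y := Real.sq_sqrt hyy.le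
  have hunit : (ρ⁻¹ • y) ⬝ᵥ (ρ⁻¹ • y) = 1 := by
    rw [smul_dotProduct, dotProduct_smul, ← hρsq, smul_eq_mul, smul_eq_mul]
    field_simp
  have h := hδ.ofReal_le_lintegral_designLaw_of_dotProduct_eq_one hδm hk hkp hL hunit ρ
  rwa [smul_inv_smul₀ hρ.ne', hρsq] at h

theorem measurable_response (σ : ℝ) (β : EuclideanSpace ℝ (Fin p)) :
    Measurable fun w : Design n p × (Fin n → ℝ) => (w.1, predict w.1 β + σ • w.2) := by
  unfold predict
  fun_prop

instance (n p : ℕ) : IsProbabilityMeasure (designLaw n p) := by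
  unfold designLaw
  infer_instance

instance (n : ℕ) : IsProbabilityMeasure (noiseLaw n) := by
  unfold noiseLaw
  infer_instance

instance (σ : ℝ) (β : EuclideanSpace ℝ (Fin p)) : IsProbabilityMeasure (dataLaw n p σ β) :=
  Measure.isProbabilityMeasure_map (measurable_response σ β).aemeasurable

theorem risk_zero (σ : ℝ) (hδm : Measurable δ) :
    risk σ δ 0 =
      ∫⁻ z, ∫⁻ x, ENNReal.ofReal (‖δ (x, σ • z)‖ ^ 2) ∂(designLaw n p) ∂(noiseLaw n) := by
  have hloss : Measurable fun d => ENNReal.ofReal (‖δ d - 0‖ ^ 2) :=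
    ((hδm.sub_const 0).norm.pow_const 2).ennreal_ofReal
  have hpredict (x : Design n p) : predict x 0 = 0 := by simp [predict_eq_mulVec]
  rw [risk, dataLaw, lintegral_map hloss (measurable_response σ 0)]
  refine (lintegral_prod_symm _ (hloss.comp (measurable_response σ 0)).aemeasurable).trans ?_
  simp only [Function.comp_apply, hpredict, zero_add, sub_zero]

theorem zero_mem_Theta (p k : ℕ) (τ : ℝ) : 0 ∈ Theta p k τ := by
  refine ⟨by simp [l0], ?_⟩
  simp only [norm_zero, ne_eq, OfNat.ofNat_ne_zero, not_false_eq_true, zero_pow]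
  positivity

theorem IsBestSubsetSelection.ofReal_le_worstRisk (hδ : IsBestSubsetSelection k δ)
    (hδm : Measurable δ) (hn : 0 < n) (hk : 1 ≤ k) (hkp : k ≤ p) (hL : 4 ≤ Real.log (p / k))
    (τ σ : ℝ) :
    ENNReal.ofReal
        (σ ^ 2 * (k * Real.log (p / k) / (864 * (1 + k * Real.log (p / k) / n) ^ 2))) ≤
      worstRisk k τ σ δ := by
  set r := k * Real.log (p / k) / (864 * (1 + k * Real.log (p / k) / n) ^ 2)
  have hn0 : (n : ℝ) ≠ 0 := by exact_mod_cast hn.ne'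
  have hmean : ∫ z, (σ • z) ⬝ᵥ (σ • z) / n * r ∂(noiseLaw n) = σ ^ 2 * r := by
    simp only [smul_dotProduct, dotProduct_smul, smul_eq_mul]
    rw [integral_mul_const, integral_div, integral_const_mul, integral_const_mul, noiseLaw,
      integral_dotProduct_self_iidGaussian]
    simp only [Fintype.card_fin, NNReal.coe_one, mul_one]
    field_simp
  have hint : Integrable (fun z => (σ • z) ⬝ᵥ (σ • z) / n * r) (noiseLaw n) := by
    simp only [smul_dotProduct, dotProduct_smul]
    exact ((((integrable_dotProduct_self_iidGaussian 1).smul σ).smul σ).div_const _).mul_const _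
  calc ENNReal.ofReal (σ ^ 2 * r)
      ≤ ∫⁻ z, ENNReal.ofReal ((σ • z) ⬝ᵥ (σ • z) / n * r) ∂(noiseLaw n) := by
        rw [← hmean]
        exact ofReal_integral_le_lintegral hint
    _ ≤ ∫⁻ z, ∫⁻ x, ENNReal.ofReal (‖δ (x, σ • z)‖ ^ 2) ∂(designLaw n p) ∂(noiseLaw n) :=
        lintegral_mono fun z => hδ.ofReal_le_lintegral_designLaw hδm hk hkp hL (σ • z)
    _ = risk σ δ 0 := (risk_zero σ hδm).symm
    _ ≤ worstRisk k τ σ δ :=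
        le_iSup₂ (f := fun β (_ : β ∈ Theta p k τ) => risk σ δ β) 0 (zero_mem_Theta p k τ)

theorem minimaxRisk_le (n p k : ℕ) (τ σ : ℝ) :
    minimaxRisk n p k τ σ ≤ ENNReal.ofReal (k * τ ^ 2) := by
  refine (iInf₂_le (fun _ => 0) measurable_const).trans (iSup₂_le fun β hβ => ?_)
  simp only [risk, zero_sub, norm_neg, lintegral_const, measure_univ, mul_one]
  exact ENNReal.ofReal_le_ofReal hβ.2

theorem IsBestSubsetSelection.ofReal_le_worstRisk_div_minimaxRisk
    (hδ : IsBestSubsetSelection k δ) (hδm : Measurable δ) (hn : 0 < n) (hk : 1 ≤ k)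
    (hkp : k ≤ p) (hL : 4 ≤ Real.log (p / k)) {τ : ℝ} (hτ : 0 < τ) (σ : ℝ) :
    ENNReal.ofReal ((√(Real.log (p / k)) / (τ / σ)) ^ 2 /
        (864 * (1 + k * Real.log (p / k) / n) ^ 2)) ≤
      worstRisk k τ σ δ / minimaxRisk n p k τ σ := by
  have hk0 : (0 : ℝ) < k := by exact_mod_cast hk
  refine le_trans (le_of_eq ?_) (ENNReal.div_le_div
    (hδ.ofReal_le_worstRisk hδm hn hk hkp hL τ σ) (minimaxRisk_le n p k τ σ))
  rw [← ENNReal.ofReal_div_of_pos (mul_pos hk0 (pow_pos hτ 2)), div_pow, Real.sq_sqrt (by linarith)]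
  congr 1
  field_simp

end WorstRisk

section Asymptotics

theorem tendsto_div_atTop_of_isLittleO {α : Type*} {l : Filter α} {f g : α → ℝ} (h : f =o[l] g)
    (hf : ∀ᶠ x in l, 0 < f x) (hg : ∀ᶠ x in l, 0 < g x) :
    Tendsto (fun x => g x / f x) l atTop := by
  have hpos : ∀ᶠ x in l, f x / g x ∈ Set.Ioi 0 := by
    filter_upwards [hf, hg] with x using div_pos
  have hinv := (tendsto_nhdsWithin_iff.2 ⟨h.tendsto_div_nhds_zero, hpos⟩).inv_tendsto_nhdsGT_zero
  simpa only [Pi.inv_def, inv_div] using hinv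

variable {p k : ℕ → ℕ}

theorem tendsto_log_div_atTop (hk : ∀ n, 1 ≤ k n) (hkp : ∀ n, k n ≤ p n)
    (hsparse : Tendsto (fun n => (k n : ℝ) / (p n : ℝ)) atTop (𝓝 0)) :
    Tendsto (fun n => Real.log ((p n : ℝ) / (k n : ℝ))) atTop atTop := by
  have hpos (n : ℕ) : (0 : ℝ) < (k n : ℝ) / (p n : ℝ) :=
    div_pos (by exact_mod_cast hk n) (by exact_mod_cast (hk n).trans (hkp n))
  have hinv := (tendsto_nhdsWithin_iff.2 ⟨hsparse, .of_forall hpos⟩).inv_tendsto_nhdsGT_zero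
  simpa only [Pi.inv_apply, inv_div, Function.comp_def] using Real.tendsto_log_atTop.comp hinv

theorem isBigO_mul_log_div_of_tendsto (hk : ∀ n, 1 ≤ k n) (hkp : ∀ n, k n ≤ p n)
    (hsample : Tendsto (fun n => (k n : ℝ) * Real.log (p n : ℝ) / (n : ℝ)) atTop (𝓝 0)) :
    (fun n => (k n : ℝ) * Real.log ((p n : ℝ) / (k n : ℝ))) =O[atTop] fun n => (n : ℝ) := by
  refine .of_bound 1 ?_
  filter_upwards [hsample.eventually_lt_const one_pos, eventually_gt_atTop 0] with n hn hn0
  have hk1 : (1 : ℝ) ≤ k n := by exact_mod_cast hk n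
  have hkp' : (k n : ℝ) ≤ p n := by exact_mod_cast hkp n
  have hn0' : (0 : ℝ) < n := by exact_mod_cast hn0
  have hratio : 1 ≤ (p n : ℝ) / k n := (one_le_div₀ (by positivity)).2 hkp'
  rw [Real.norm_of_nonneg (mul_nonneg (by positivity) (Real.log_nonneg hratio)),
    Real.norm_of_nonneg hn0'.le, one_mul]
  calc (k n : ℝ) * Real.log (p n / k n)
      ≤ k n * Real.log (p n) := by
        gcongr
        exact div_le_self (by positivity) hk1
    _ ≤ n := ((div_lt_one hn0').1 hn).le

end Asymptotics

end SparseRegression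

theorem mainTheorem2_general (p k : ℕ → ℕ) (τ σ : ℕ → ℝ)
    (hk : ∀ n, 1 ≤ k n) (hkp : ∀ n, k n ≤ p n)
    (hτ : ∀ n, 0 < τ n) (hσ : ∀ n, 0 < σ n)
    (hsparse : Tendsto (fun n => (k n : ℝ) / (p n : ℝ)) atTop (𝓝 0))
    (hsample : (fun n => (k n : ℝ) * Real.log ((p n : ℝ) / (k n : ℝ))) =O[atTop]
      fun n => (n : ℝ))
    (hsnr : (fun n => τ n / σ n) =o[atTop]
      fun n => Real.sqrt (Real.log ((p n : ℝ) / (k n : ℝ))))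
    (βBS : ∀ n, SparseRegression.Estimator n (p n))
    (hmeas : ∀ n, Measurable (βBS n))
    (hBS : ∀ n, SparseRegression.IsBestSubsetSelection (k n) (βBS n)) :
    Tendsto
      (fun n => SparseRegression.worstRisk (k n) (τ n) (σ n) (βBS n) /
        SparseRegression.minimaxRisk n (p n) (k n) (τ n) (σ n))
      atTop (𝓝 ⊤) := by
  have hlog := SparseRegression.tendsto_log_div_atTop hk hkp hsparse
  have hratio := SparseRegression.tendsto_div_atTop_of_isLittleO hsnr
    (.of_forall fun n => div_pos (hτ n) (hσ n))
    ((hlog.eventually_gt_atTop 0).mono fun n hL => Real.sqrt_pos.2 hL)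
  obtain ⟨C, hC, hbound⟩ := hsample.exists_pos
  have hlower : Tendsto (fun n => (√(Real.log ((p n : ℝ) / (k n : ℝ))) / (τ n / σ n)) ^ 2 /
      (864 * (1 + C) ^ 2)) atTop atTop :=
    ((tendsto_pow_atTop two_ne_zero).comp hratio).atTop_div_const (by positivity)
  refine tendsto_nhds_top_mono (ENNReal.tendsto_ofReal_atTop.comp hlower) ?_
  filter_upwards [hlog.eventually_ge_atTop 4, hbound.bound, eventually_gt_atTop 0]
    with n hL hle hn
  have hn0 : (0 : ℝ) < n := by exact_mod_cast hn
  have hnonneg : 0 ≤ (k n : ℝ) * Real.log (p n / k n) := mul_nonneg (by positivity) (by linarith)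
  rw [Real.norm_of_nonneg hnonneg, Real.norm_of_nonneg hn0.le, ← div_le_iff₀ hn0] at hle
  refine le_trans (ENNReal.ofReal_le_ofReal ?_)
    ((hBS n).ofReal_le_worstRisk_div_minimaxRisk (hmeas n) hn (hk n) (hkp n) hL (hτ n) (σ n))
  dsimp only [Function.comp_apply]
  gcongr

theorem mainTheorem2 (p k : ℕ → ℕ) (τ σ : ℕ → ℝ)
    (hk : ∀ n, 1 ≤ k n) (hkp : ∀ n, k n ≤ p n)
    (hτ : ∀ n, 0 < τ n) (hσ : ∀ n, 0 < σ n)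
    (hsparse : Tendsto (fun n => (k n : ℝ) / (p n : ℝ)) atTop (𝓝 0))
    (hsample : Tendsto (fun n => (k n : ℝ) * Real.log (p n : ℝ) / (n : ℝ)) atTop (𝓝 0))
    (hsnr : (fun n => τ n / σ n) =o[atTop]
      fun n => Real.sqrt (Real.log ((p n : ℝ) / (k n : ℝ))))
    (βBS : ∀ n, SparseRegression.Estimator n (p n))
    (hmeas : ∀ n, Measurable (βBS n))
    (hBS : ∀ n, SparseRegression.IsBestSubsetSelection (k n) (βBS n)) :
    Tendsto
      (fun n => SparseRegression.worstRisk (k n) (τ n) (σ n) (βBS n) /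
        SparseRegression.minimaxRisk n (p n) (k n) (τ n) (σ n))
      atTop (𝓝 ⊤) :=
  mainTheorem2_general p k τ σ hk hkp hτ hσ hsparse
    (SparseRegression.isBigO_mul_log_div_of_tendsto hk hkp hsample) hsnr βBS hmeas hBS
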